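/- Theorem E. Let $\mathbb{N}$ be the set of positive integers. A minimal system $(X,T)$ is a nonempty compact metric space $X$ with a continuous map $T: X \to X$ such that the only nonempty closed set $Y \subseteq X$ with $TY \subseteq Y$ is $Y = X$. For $x \in X$ and $U \subseteq X$ put $R(x,U) = \{n \in \mathbb{N} : T^n x \in U\}$. A set $A \subseteq \mathbb{N}$ is dynamically thick if $A \cap R(x,U) \neq \emptyset$ for all minimal systems $(X,T)$, all $x \in X$ and all nonempty open $U \subseteq X$; it is a set of pointwise recurrence if the same holds for all open $U \subseteq X$ that contain $x$. It is dynamically syndetic if it contains $R(x,U)$ for some minimal system $(X,T)$, some $x \in X$ and some nonempty open $U \subseteq X$; it is dynamically central syndetic if, moreover, this is possible with $x \in U$. The dual of a family of subsets of $\mathbb{N}$ consists of all subsets of $\mathbb{N}$ that have nonempty intersection with every member of the family. A family is $\sigma$-compact if the set of indicator functions of its members is a $\sigma$-compact subset of $\{0,1\}^{\mathbb{N}}$ (with the product topology). Then the dual of the family of dynamically thick sets is the family of dynamically syndetic sets, the dual of the family of sets of pointwise recurrence is the family of dynamically central syndetic sets, and neither of these two dual families is $\sigma$-compact. -/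

import Mathlib

/-- `(X, T)` is a minimal system: `T` is a continuous self-map of `X`, and the only nonempty,
closed set `Y ⊆ X` with `T Y ⊆ Y` is `X` itself. (That `X` is a nonempty, compact metric space is
required wherever this is used.) -/
structure IsMinimalSystem {X : Type*} [TopologicalSpace X] (T : X → X) : Prop where
  continuous : Continuous T
  eq_univ : ∀ Y : Set X, Y.Nonempty → IsClosed Y → Set.MapsTo T Y Y → Y = Set.univ

/-- `R(x, U) = {n ∈ ℕ | Tⁿ x ∈ U}`, where `ℕ` is the set of positive integers. -/
def returnTimes {X : Type*} (T : X → X) (x : X) (U : Set X) : Set ℕ+ :=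
  {n | T^[(n : ℕ)] x ∈ U}

/-- The dynamically thick sets of positive integers. Every compact metric space has at most
continuum many points, so nothing is lost by letting systems range over `Type`. -/
def dynamicallyThick : Set (Set ℕ+) :=
  {A | ∀ (X : Type) [MetricSpace X] [CompactSpace X] [Nonempty X] (T : X → X),
    IsMinimalSystem T → ∀ (x : X) (U : Set X), IsOpen U → U.Nonempty →
      ∃ n ∈ A, T^[(n : ℕ)] x ∈ U}

/-- The sets of (minimal, topological) pointwise recurrence. -/
def pointwiseRecurrence : Set (Set ℕ+) :=
  {A | ∀ (X : Type) [MetricSpace X] [CompactSpace X] [Nonempty X] (T : X → X),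
    IsMinimalSystem T → ∀ (x : X) (U : Set X), IsOpen U → x ∈ U →
      ∃ n ∈ A, T^[(n : ℕ)] x ∈ U}

/-- The dynamically syndetic sets: those that contain some `R(x, U)`, where `(X, T)` is minimal,
`x ∈ X`, and `U ⊆ X` is nonempty and open. -/
def dynamicallySyndetic : Set (Set ℕ+) :=
  {A | ∃ (X : Type) (_ : MetricSpace X) (_ : CompactSpace X) (_ : Nonempty X) (T : X → X),
    IsMinimalSystem T ∧ ∃ (x : X) (U : Set X), IsOpen U ∧ U.Nonempty ∧ returnTimes T x U ⊆ A}

/-- The dynamically central syndetic sets: as above, with `x ∈ U`. -/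
def dynamicallyCentralSyndetic : Set (Set ℕ+) :=
  {A | ∃ (X : Type) (_ : MetricSpace X) (_ : CompactSpace X) (_ : Nonempty X) (T : X → X),
    IsMinimalSystem T ∧ ∃ (x : X) (U : Set X), IsOpen U ∧ x ∈ U ∧ returnTimes T x U ⊆ A}

/-- The dual of a family: the sets that have nonempty intersection with all of its members. -/
def dualFamily (F : Set (Set ℕ+)) : Set (Set ℕ+) :=
  {B | ∀ A ∈ F, (B ∩ A).Nonempty}

/-- A family is σ-compact if the set of indicator functions of its members is a σ-compact subset
of `{0,1}^ℕ` with the product topology. -/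
def IsSigmaCompactFamily (F : Set (Set ℕ+)) : Prop :=
  IsSigmaCompact (Set.boolIndicator '' F : Set (ℕ+ → Bool))

/-! ### Duality -/

/-! The dualities are formal: a set fails to contain any of the relevant return sets exactly when
its complement meets all of them. Against σ-compactness, diagonalise over closed families `K k` of
dynamically syndetic sets. Repeat a word of length `l` that contains a `false`, inserting one extra
letter ever more rarely. The copies then stay in each residue class mod `l` for longer and longer
stretches, so the support has unbounded gaps in every class. Return times in a minimal system have
bounded gaps in some class (`IsMinimalSystem.exists_bounded_gaps_in_residue_class`), so the support
is not dynamically syndetic, and as `K k` is closed, a finite prefix already excludes it from `K k`.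
That prefix is the next word. Spacers never accumulate (`IsTiling.trans`), so the limit sequence is
uniformly recurrent and its support is dynamically central syndetic, but lies in no `K k`. -/

theorem dualFamily_dynamicallyThick : dualFamily dynamicallyThick = dynamicallySyndetic := by
  ext B
  constructor
  · intro hB
    by_contra hS
    have hT : Bᶜ ∈ dynamicallyThick := by
      intro X _ _ _ T hT x U hU hne
      by_contra! h
      exact hS ⟨X, _, inferInstance, inferInstance, T, hT, x, U, hU, hne, fun n hn => by
        by_contra hnB
        exact h n hnB hn⟩
    obtain ⟨n, hn, hn'⟩ := hB _ hT
    exact hn' hn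
  · rintro ⟨X, _, _, _, T, hT, x, U, hU, hne, hsub⟩ A hA
    obtain ⟨n, hnA, hn⟩ := hA X T hT x U hU hne
    exact ⟨n, hsub hn, hnA⟩

theorem dualFamily_pointwiseRecurrence :
    dualFamily pointwiseRecurrence = dynamicallyCentralSyndetic := by
  ext B
  constructor
  · intro hB
    by_contra hS
    have hT : Bᶜ ∈ pointwiseRecurrence := by
      intro X _ _ _ T hT x U hU hne
      by_contra! h
      exact hS ⟨X, _, inferInstance, inferInstance, T, hT, x, U, hU, hne, fun n hn => by
        by_contra hnB
        exact h n hnB hn⟩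
    obtain ⟨n, hn, hn'⟩ := hB _ hT
    exact hn' hn
  · rintro ⟨X, _, _, _, T, hT, x, U, hU, hne, hsub⟩ A hA
    obtain ⟨n, hnA, hn⟩ := hA X T hT x U hU hne
    exact ⟨n, hsub hn, hnA⟩

theorem dynamicallyCentralSyndetic_subset :
    dynamicallyCentralSyndetic ⊆ dynamicallySyndetic := by
  rintro A ⟨X, _, _, _, T, hT, x, U, hU, hx, hsub⟩
  exact ⟨X, _, inferInstance, inferInstance, T, hT, x, U, hU, ⟨x, hx⟩, hsub⟩

/-! ### Minimal sets and return times along arithmetic progressions -/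

section Minimal

variable {X : Type*} [TopologicalSpace X]

/-- Every continuous self-map of a nonempty compact space has a minimal set. -/
theorem exists_minimal_closed_mapsTo [CompactSpace X] [Nonempty X] (f : X → X) :
    ∃ M : Set X, M.Nonempty ∧ IsClosed M ∧ Set.MapsTo f M M ∧
      ∀ Y ⊆ M, Y.Nonempty → IsClosed Y → Set.MapsTo f Y Y → Y = M := by
  obtain ⟨M, hM⟩ := zorn_superset {Y : Set X | Y.Nonempty ∧ IsClosed Y ∧ Set.MapsTo f Y Y} (by
    intro c hc hchain
    rcases c.eq_empty_or_nonempty with rfl | hne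
    · exact ⟨Set.univ, ⟨Set.univ_nonempty, isClosed_univ, Set.mapsTo_univ _ _⟩, by simp⟩
    · refine ⟨⋂₀ c, ⟨?_, isClosed_sInter fun s hs => (hc hs).2.1, ?_⟩,
        fun s hs => Set.sInter_subset_of_mem hs⟩
      · have : Nonempty c := hne.to_subtype
        exact IsCompact.nonempty_sInter_of_directed_nonempty_isCompact_isClosed
          (IsChain.directedOn hchain.symm) (fun s hs => (hc hs).1)
          (fun s hs => (hc hs).2.1.isCompact) (fun s hs => (hc hs).2.1)
      · intro x hx s hs
        exact (hc hs).2.2 (hx s hs))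
  refine ⟨M, hM.prop.1, hM.prop.2.1, hM.prop.2.2, fun Y hY h1 h2 h3 => ?_⟩
  exact hM.eq_of_subset ⟨h1, h2, h3⟩ hY

/-- Return times to an open set that meets a minimal set have uniformly bounded gaps. -/
theorem exists_bounded_hitting_time [CompactSpace X] {f : X → X} (hf : Continuous f)
    {M : Set X} (hMc : IsClosed M) (hMf : Set.MapsTo f M M)
    (hmin : ∀ Y ⊆ M, Y.Nonempty → IsClosed Y → Set.MapsTo f Y Y → Y = M)
    {V : Set X} (hV : IsOpen V) (hne : (M ∩ V).Nonempty) :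
    ∃ L : ℕ, ∀ z ∈ M, ∃ j < L, f^[j] z ∈ V := by
  have hcover : M ⊆ ⋃ j : ℕ, f^[j] ⁻¹' V := by
    by_contra hnot
    obtain ⟨z, hzM, hz⟩ := Set.not_subset.1 hnot
    -- The points of `M` that never visit `V` form a closed invariant set; if nonempty, it would be
    -- all of `M`.
    have hY := hmin (M ∩ ⋂ j : ℕ, (f^[j] ⁻¹' V)ᶜ) Set.inter_subset_left
      ⟨z, hzM, by simpa using hz⟩
      (hMc.inter (isClosed_iInter fun j => (hV.preimage (hf.iterate j)).isClosed_compl))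
      (by
        rintro y ⟨hyM, hy⟩
        refine ⟨hMf hyM, Set.mem_iInter.2 fun j => ?_⟩
        have := Set.mem_iInter.1 hy (j + 1)
        simpa [Function.iterate_succ_apply] using this)
    obtain ⟨v, hvM, hvV⟩ := hne
    rw [← hY] at hvM
    exact Set.mem_iInter.1 hvM.2 0 hvV
  obtain ⟨t, ht⟩ := hMc.isCompact.elim_finite_subcover _
    (fun j => hV.preimage (hf.iterate j)) hcover
  refine ⟨t.sup id + 1, fun z hz => ?_⟩
  obtain ⟨j, hj, hjz⟩ := Set.mem_iUnion₂.1 (ht hz)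
  exact ⟨j, Nat.lt_succ_of_le (Finset.le_sup (f := id) hj), hjz⟩

/-- In a minimal system, the times in some residue class modulo `l` at which a given point visits
a given nonempty open set are relatively dense in that class. -/
theorem IsMinimalSystem.exists_bounded_gaps_in_residue_class [CompactSpace X] [Nonempty X]
    [T2Space X] {T : X → X} (hT : IsMinimalSystem T) (x : X) {U : Set X} (hU : IsOpen U)
    (hne : U.Nonempty) {l : ℕ} (hl : 0 < l) :
    ∃ c L : ℕ, ∀ i : ℕ, ∃ j < L, T^[c + l * (i + j)] x ∈ U := by
  have hc := hT.continuous
  obtain ⟨M, hMne, hMc, hMf, hmin⟩ := exists_minimal_closed_mapsTo (T^[l])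
  -- With `M` minimal for `T^[l]`, this finite union is closed and `T`-invariant, hence everything.
  have hx : x ∈ ⋃ a ∈ Set.Iio l, T^[a] '' M := by
    rw [hT.eq_univ (⋃ a ∈ Set.Iio l, T^[a] '' M)]
    · trivial
    · obtain ⟨z, hz⟩ := hMne
      exact ⟨z, Set.mem_biUnion (x := 0) hl ⟨z, hz, rfl⟩⟩
    · exact (Set.finite_Iio l).isClosed_biUnion fun a _ =>
        (hMc.isCompact.image (hc.iterate a)).isClosed
    · intro y hy
      obtain ⟨a, ha, z, hz, rfl⟩ := Set.mem_iUnion₂.1 hy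
      rw [← Function.iterate_succ_apply' T a z]
      rcases Nat.lt_or_ge (a + 1) l with h | h
      · exact Set.mem_biUnion (x := a + 1) h ⟨z, hz, rfl⟩
      · obtain rfl : l = a + 1 := le_antisymm h ha
        exact Set.mem_biUnion (x := 0) hl ⟨_, hMf hz, rfl⟩
  obtain ⟨a, -, z, hz, rfl⟩ := Set.mem_iUnion₂.1 hx
  obtain ⟨L₀, hL₀⟩ := exists_bounded_hitting_time hc isClosed_univ (Set.mapsTo_univ T _)
    (fun Y _ h1 h2 h3 => hT.eq_univ Y h1 h2 h3) hU (by simpa using hne)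
  obtain ⟨c, -, hcU⟩ := hL₀ (T^[a] z) trivial
  rw [← Function.iterate_add_apply] at hcU
  obtain ⟨L, hL⟩ := exists_bounded_hitting_time (hc.iterate l) hMc hMf hmin
    (hU.preimage (hc.iterate (c + a))) ⟨z, hz, hcU⟩
  refine ⟨c, L, fun i => ?_⟩
  obtain ⟨j, hj, hjU⟩ := hL _ (hMf.iterate i hz)
  refine ⟨j, hj, ?_⟩
  rw [← Function.iterate_add_apply, ← Function.iterate_mul, Set.mem_preimage,
    ← Function.iterate_add_apply] at hjU
  rw [← Function.iterate_add_apply]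
  convert hjU using 2
  ring

end Minimal

/-! ### Sets of positive integers given by `0`-`1`-sequences -/

/-- The set of positive integers at which the sequence `y` is `true`. -/
def positiveSupport (y : ℕ → Bool) : Set ℕ+ := {n | y n = true}

theorem boolIndicator_positiveSupport (y : ℕ → Bool) :
    (positiveSupport y).boolIndicator = fun n : ℕ+ => y n := by
  funext n
  by_cases h : y n = true
  · rw [h]
    exact (Set.mem_iff_boolIndicator _ _).1 h
  · rw [(Set.notMem_iff_boolIndicator _ _).1 (show n ∉ positiveSupport y from h)]
    exact (Bool.eq_false_iff.2 h).symm

/-- The left shift on `0`-`1`-sequences. -/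
def leftShift (y : ℕ → Bool) : ℕ → Bool := fun n => y (n + 1)

theorem continuous_leftShift : Continuous leftShift :=
  continuous_pi fun n => continuous_apply (n + 1)

theorem iterate_leftShift_apply (m : ℕ) (y : ℕ → Bool) (n : ℕ) :
    leftShift^[m] y n = y (n + m) := by
  induction m generalizing y with
  | zero => rfl
  | succ m ih => rw [Function.iterate_succ_apply, ih]; simp only [leftShift, add_assoc, add_comm m]

/-- Basic open sets constrain finitely many coordinates. The map `e` serves both sequences on `ℕ`
and their restrictions to `ℕ+`. -/
theorem exists_prefix_subset {ι : Type*} {e : ι → ℕ} {O : Set (ι → Bool)}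
    (hO : IsOpen O) {y : ℕ → Bool} (hy : (fun i => y (e i)) ∈ O) :
    ∃ N : ℕ, ∀ z : ℕ → Bool, (∀ n < N, z n = y n) → (fun i => z (e i)) ∈ O := by
  obtain ⟨I, u, hu, hsub⟩ := isOpen_pi_iff.1 hO _ hy
  refine ⟨I.sup e + 1, fun z hz => hsub fun i hi => ?_⟩
  rw [hz _ (Nat.lt_succ_of_le (Finset.le_sup hi))]
  exact (hu i hi).2

/-- The support of a uniformly recurrent sequence beginning with `true` is dynamically central
syndetic. -/
theorem positiveSupport_mem_dynamicallyCentralSyndetic {x : ℕ → Bool} (hx0 : x 0 = true)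
    (hrec : ∀ l, ∃ D, ∀ n, ∃ j < D, ∀ i < l, x (n + j + i) = x i) :
    positiveSupport x ∈ dynamicallyCentralSyndetic := by
  let Z : Set (ℕ → Bool) := closure (Set.range fun m => leftShift^[m] x)
  have hxZ : x ∈ Z := subset_closure ⟨0, rfl⟩
  have hZ : Set.MapsTo leftShift Z Z := by
    refine Set.MapsTo.closure ?_ continuous_leftShift
    rintro _ ⟨m, rfl⟩
    exact ⟨m + 1, Function.iterate_succ_apply' _ _ _⟩
  have hiter : ∀ (m : ℕ) (z : Z), ((hZ.restrict leftShift Z Z)^[m] z : ℕ → Bool) =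
      leftShift^[m] z := by
    intro m
    induction m with
    | zero => intro z; rfl
    | succ m ih => intro z; rw [Function.iterate_succ_apply, ih]; rfl
  have hminimal : IsMinimalSystem (hZ.restrict leftShift Z Z) := by
    refine ⟨continuous_leftShift.restrict hZ, fun Y hYne hYc hYT => ?_⟩
    have hxY : (⟨x, hxZ⟩ : Z) ∈ Y := by
      rw [← hYc.closure_eq, mem_closure_iff]
      intro O hO hxO
      obtain ⟨O', hO', rfl⟩ := isOpen_induced_iff.1 hO
      obtain ⟨N, hN⟩ := exists_prefix_subset (e := id) hO' hxO
      -- A prefix of `y` of length `D + N` occurs in `x`, so it contains the first `N` letters of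
      -- `x` at some offset `j < D`.
      obtain ⟨D, hD⟩ := hrec N
      obtain ⟨y, hy⟩ := hYne
      have hopen : IsOpen {z : ℕ → Bool | ∀ i ∈ Finset.range (D + N), z i = y.1 i} := by
        simp only [Set.ofPred_forall]
        refine isOpen_biInter_finset fun i _ => ?_
        have hi : IsOpen ((fun z : ℕ → Bool => z i) ⁻¹' {y.1 i}) :=
          (isOpen_discrete _).preimage (continuous_apply i)
        exact hi
      obtain ⟨_, hz, m, rfl⟩ := mem_closure_iff.1 y.2 _ hopen fun _ _ => rfl
      obtain ⟨j, hj, hji⟩ := hD m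
      refine ⟨(hZ.restrict leftShift Z Z)^[j] y, ?_, hYT.iterate j hy⟩
      rw [Set.mem_preimage, hiter]
      refine hN _ fun n hn => ?_
      have hzn : leftShift^[m] x (n + j) = y.1 (n + j) :=
        hz (n + j) (Finset.mem_range.2 (by omega))
      rw [iterate_leftShift_apply] at hzn ⊢
      rw [← hzn, show n + j + m = m + j + n by ring]
      exact hji n hn
    rw [Set.eq_univ_iff_forall]
    rintro ⟨z, hz⟩
    have hsub : Z ⊆ Subtype.val '' Y := by
      refine closure_minimal ?_ (isClosed_closure.isClosedEmbedding_subtypeVal.isClosedMap _ hYc)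
      rintro _ ⟨m, rfl⟩
      exact ⟨_, hYT.iterate m hxY, hiter m _⟩
    obtain ⟨z', hz', rfl⟩ := hsub hz
    exact hz'
  let : MetricSpace Z := TopologicalSpace.metrizableSpaceMetric Z
  have : CompactSpace Z := isCompact_iff_compactSpace.1 isClosed_closure.isCompact
  refine ⟨Z, inferInstance, inferInstance, ⟨⟨x, hxZ⟩⟩, hZ.restrict leftShift Z Z, hminimal,
    ⟨x, hxZ⟩, {z | z.1 0 = true}, ?_, hx0, fun n hn => ?_⟩
  · have h0 : IsOpen ((fun z : Z => z.1 0) ⁻¹' {true}) :=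
      (isOpen_discrete _).preimage ((continuous_apply 0).comp continuous_subtype_val)
    exact h0
  · have hn' : ((hZ.restrict leftShift Z Z)^[(n : ℕ)] ⟨x, hxZ⟩).1 0 = true := hn
    rw [hiter, iterate_leftShift_apply, zero_add] at hn'
    exact hn'

/-! ### Drifting repetitions of a word -/

open Classical in
/-- Copies of the word `w 0, …, w (l - 1)` placed at the positions `l * m + √m`, with `false`
elsewhere. -/
noncomputable def drift (w : ℕ → Bool) (l : ℕ) (n : ℕ) : Bool :=
  decide (∃ m i, i < l ∧ n = l * m + Nat.sqrt m + i ∧ w i = true)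

theorem drift_start_add_le {l m m' : ℕ} (h : m < m') :
    l * m + Nat.sqrt m + l ≤ l * m' + Nat.sqrt m' := by
  have h1 : l * (m + 1) ≤ l * m' := Nat.mul_le_mul_left _ h
  have h2 := Nat.sqrt_le_sqrt h.le
  rw [mul_add_one] at h1
  omega

theorem drift_apply (w : ℕ → Bool) {l i : ℕ} (m : ℕ) (hi : i < l) :
    drift w l (l * m + Nat.sqrt m + i) = w i := by
  rw [Bool.eq_iff_iff]
  simp only [drift, decide_eq_true_eq]
  refine ⟨?_, fun h => ⟨m, i, hi, rfl, h⟩⟩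
  rintro ⟨m', i', hi', heq, hw⟩
  rcases lt_trichotomy m m' with h | rfl | h
  · have := drift_start_add_le (l := l) h
    omega
  · obtain rfl : i = i' := by omega
    exact hw
  · have := drift_start_add_le (l := l) h
    omega

theorem drift_apply_of_lt (w : ℕ → Bool) {l i : ℕ} (hi : i < l) : drift w l i = w i := by
  simpa using drift_apply w 0 hi

/-- While `√m = k`, the letter `b` of the copies puts `false` at all the positions `l * m + k + b`,
a long progression in the class of `k + b`. -/
theorem positiveSupport_drift_notMem {w : ℕ → Bool} {l b : ℕ} (hb : b < l) (hw : w b = false) :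
    positiveSupport (drift w l) ∉ dynamicallySyndetic := by
  rintro ⟨X, _, _, _, T, hT, x, U, hU, hne, hsub⟩
  have hl : 0 < l := by omega
  obtain ⟨c, L, hcL⟩ := hT.exists_bounded_gaps_in_residue_class x hU hne hl
  -- This `k` makes `k + b` congruent to `c` mod `l` and exceeds `L`, so `√(k * k + j) = k` for all
  -- `j < L`.
  obtain ⟨k, hk⟩ : ∃ k, k + b = c + l * (b + L + 1) :=
    ⟨c + l * (b + L + 1) - b, Nat.sub_add_cancel (by nlinarith)⟩
  have hkL : L < k := by nlinarith
  obtain ⟨j, hj, hjU⟩ := hcL (k * k + (b + L + 1))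
  have htime : c + l * (k * k + (b + L + 1) + j) = l * (k * k + j) + k + b := by
    linear_combination -hk
  have hsqrt : Nat.sqrt (k * k + j) = k := Nat.sqrt_add_eq k (by omega)
  have hmem := hsub (show (⟨l * (k * k + j) + k + b, by omega⟩ : ℕ+) ∈ returnTimes T x U from
    htime ▸ hjU)
  have hval : drift w l (l * (k * k + j) + k + b) = true := hmem
  have hdrift := drift_apply w (k * k + j) hb
  rw [hsqrt, hval, hw] at hdrift
  exact absurd hdrift (by decide)

/-! ### Tilings -/

/-- `S` is the set of starting positions of the tiles in a tiling of `x` by the word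
`w 0, …, w (l - 1)`, where consecutive tiles are at most one letter apart. -/
structure IsTiling (w : ℕ → Bool) (l : ℕ) (x : ℕ → Bool) (S : Set ℕ) : Prop where
  zero_mem : 0 ∈ S
  apply_eq : ∀ s ∈ S, ∀ i < l, x (s + i) = w i
  next_mem : ∀ s ∈ S, s + l ∈ S ∨ s + l + 1 ∈ S
  add_le : ∀ s ∈ S, ∀ t ∈ S, s < t → s + l ≤ t

theorem isTiling_drift (w : ℕ → Bool) (l : ℕ) :
    IsTiling w l (drift w l) (Set.range fun m => l * m + Nat.sqrt m) where
  zero_mem := ⟨0, by simp⟩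
  apply_eq := by
    rintro _ ⟨m, rfl⟩ i hi
    exact drift_apply w m hi
  next_mem := by
    rintro _ ⟨m, rfl⟩
    have h1 := Nat.sqrt_le_sqrt (show m ≤ m + 1 by omega)
    have h2 : Nat.sqrt (m + 1) ≤ Nat.sqrt m + 1 := Nat.sqrt_succ_le_succ_sqrt m
    have h3 : Nat.sqrt (m + 1) = Nat.sqrt m ∨ Nat.sqrt (m + 1) = Nat.sqrt m + 1 := by omega
    rcases h3 with h | h
    · exact Or.inl ⟨m + 1, by simp only [h]; ring⟩
    · exact Or.inr ⟨m + 1, by simp only [h]; ring⟩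
  add_le := by
    rintro _ ⟨m, rfl⟩ _ ⟨m', rfl⟩ h
    rcases lt_trichotomy m m' with h' | rfl | h'
    · exact drift_start_add_le h'
    · exact absurd h (lt_irrefl _)
    · have := drift_start_add_le (l := l) h'
      dsimp only at h
      omega

/-- Each long tile ends exactly where its last short tile, begun at `t`, ends. The gap between short
tiles across a boundary is thus the gap between the long ones, still at most one letter. -/
theorem IsTiling.trans {w y x : ℕ → Bool} {l t : ℕ} {S S' : Set ℕ} (h : IsTiling w l y S)
    (ht : t ∈ S) (h' : IsTiling y (t + l) x S') :
    IsTiling w l x {n | ∃ s' ∈ S', ∃ s ∈ S, s ≤ t ∧ n = s' + s} where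
  zero_mem := ⟨0, h'.zero_mem, 0, h.zero_mem, by omega, rfl⟩
  apply_eq := by
    rintro _ ⟨s', hs', s, hs, hst, rfl⟩ i hi
    rw [add_assoc, h'.apply_eq s' hs' _ (by omega), h.apply_eq s hs i hi]
  next_mem := by
    rintro _ ⟨s', hs', s, hs, hst, rfl⟩
    rcases hst.eq_or_lt with rfl | hlt
    · rcases h'.next_mem s' hs' with hn | hn
      · exact Or.inl ⟨_, hn, 0, h.zero_mem, by omega, by omega⟩
      · exact Or.inr ⟨_, hn, 0, h.zero_mem, by omega, by omega⟩
    · have hle := h.add_le s hs t ht hlt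
      by_cases hmem : s + l ∈ S
      · exact Or.inl ⟨s', hs', s + l, hmem, hle, by omega⟩
      · have hne : s + l ≠ t := fun he => hmem (he ▸ ht)
        exact Or.inr ⟨s', hs', s + l + 1, (h.next_mem s hs).resolve_left hmem, by omega, by omega⟩
  add_le := by
    rintro _ ⟨s', hs', s, hs, hst, rfl⟩ _ ⟨r', hr', r, hr, hrt, rfl⟩ hlt
    rcases lt_trichotomy s' r' with hsr | rfl | hsr
    · have := h'.add_le s' hs' r' hr' hsr
      omega
    · have := h.add_le s hs r hr (by omega)
      omega
    · have := h'.add_le r' hr' s' hs' hsr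
      omega

theorem IsTiling.exists_mem_between {w x : ℕ → Bool} {l : ℕ} {S : Set ℕ} (h : IsTiling w l x S)
    (hl : 0 < l) (n : ℕ) : ∃ j ≤ l, n + j ∈ S := by
  induction n with
  | zero => exact ⟨0, by omega, h.zero_mem⟩
  | succ n ih =>
    obtain ⟨j, hj, hmem⟩ := ih
    rcases Nat.eq_zero_or_pos j with rfl | hpos
    · rcases h.next_mem _ hmem with hn | hn
      · exact ⟨l - 1, by omega, by convert hn using 1; omega⟩
      · exact ⟨l, le_rfl, by convert hn using 1; omega⟩
    · exact ⟨j - 1, by omega, by convert hmem using 1; omega⟩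

/-! ### The diagonal construction -/

theorem exists_drift_prefix_avoiding {K : Set (ℕ+ → Bool)} (hK : IsClosed K)
    (hKS : ∀ A : Set ℕ+, A.boolIndicator ∈ K → A ∈ dynamicallySyndetic)
    {w : ℕ → Bool} {l b : ℕ} (hb : b < l) (hw : w b = false) :
    ∃ t ∈ Set.range fun m => l * m + Nat.sqrt m, 0 < t ∧
      ∀ z : ℕ → Bool, (∀ n < t + l, z n = drift w l n) →
        (positiveSupport z).boolIndicator ∉ K := by
  have hmem : (fun n : ℕ+ => drift w l n) ∈ Kᶜ := by
    rw [← boolIndicator_positiveSupport]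
    exact fun h => positiveSupport_drift_notMem hb hw (hKS _ h)
  obtain ⟨N, hN⟩ := exists_prefix_subset hK.isOpen_compl hmem
  -- Tile `N + 1` starts beyond `N`; cutting at its end keeps the decisive letters and a whole
  -- number of tiles.
  refine ⟨_, ⟨N + 1, rfl⟩, by positivity, fun z hz => ?_⟩
  rw [boolIndicator_positiveSupport]
  refine hN z fun n hn => hz n ?_
  dsimp only
  have : N + 1 ≤ l * (N + 1) := Nat.le_mul_of_pos_left _ (by omega)
  omega

/-- No countable union of closed families of dynamically syndetic sets contains all dynamically
central syndetic sets. -/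
theorem exists_centralSyndetic_avoiding {K : ℕ → Set (ℕ+ → Bool)} (hK : ∀ k, IsClosed (K k))
    (hKS : ∀ k, ∀ A : Set ℕ+, A.boolIndicator ∈ K k → A ∈ dynamicallySyndetic) :
    ∃ A ∈ dynamicallyCentralSyndetic, ∀ k, A.boolIndicator ∉ K k := by
  -- Only the first `p.2` letters form the word. The initial `true` gives centrality, the `false`
  -- lets the drift argument apply.
  let W := {p : (ℕ → Bool) × ℕ // p.1 0 = true ∧ ∃ b < p.2, p.1 b = false}
  have hstep : ∀ (k : ℕ) (p : W), ∃ q : W, q.1.1 = drift p.1.1 p.1.2 ∧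
      (∃ t ∈ Set.range fun m => p.1.2 * m + Nat.sqrt m, 0 < t ∧ q.1.2 = t + p.1.2) ∧
      ∀ z : ℕ → Bool, (∀ n < q.1.2, z n = q.1.1 n) → (positiveSupport z).boolIndicator ∉ K k := by
    rintro k ⟨⟨w, l⟩, hw0, b, hb, hwb⟩
    obtain ⟨t, ht, ht0, hz⟩ := exists_drift_prefix_avoiding (hK k) (hKS k) hb hwb
    refine ⟨⟨(drift w l, t + l), ?_, b, ?_, ?_⟩, rfl, ⟨t, ht, ht0, rfl⟩, hz⟩
    · exact (drift_apply_of_lt w (by simp only at hb; omega)).trans hw0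
    · simp only at hb ⊢
      omega
    · exact (drift_apply_of_lt w hb).trans hwb
  choose next hnext hlen havoid using hstep
  let p : ℕ → W := fun k => Nat.rec ⟨(fun n => decide (n = 0), 2), by simp, 1, by simp⟩ next k
  let w : ℕ → ℕ → Bool := fun k => (p k).1.1
  let l : ℕ → ℕ := fun k => (p k).1.2
  have hw : ∀ k, w (k + 1) = drift (w k) (l k) := fun k => hnext k (p k)
  have hl : ∀ k, ∃ t ∈ Set.range fun m => l k * m + Nat.sqrt m, 0 < t ∧ l (k + 1) = t + l k :=
    fun k => hlen k (p k)
  have hw0 : ∀ k, w k 0 = true := fun k => (p k).2.1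
  have hlt : ∀ k, k < l k := by
    intro k
    induction k with
    | zero => exact Nat.zero_lt_two
    | succ k ih =>
      obtain ⟨t, -, ht, he⟩ := hl k
      omega
  have hmono : Monotone l := monotone_nat_of_le_succ fun k => by
    obtain ⟨t, -, ht, he⟩ := hl k
    omega
  have hagree : ∀ k j, k ≤ j → ∀ n < l k, w j n = w k n := by
    intro k j hkj
    induction j, hkj using Nat.le_induction with
    | base => intro n _; rfl
    | succ j hj ih =>
      intro n hn
      rw [hw, drift_apply_of_lt _ (hn.trans_le (hmono hj)), ih n hn]
  let x : ℕ → Bool := fun n => w n n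
  have hx : ∀ k, ∀ n < l k, x n = w k n := by
    intro k n hn
    rcases le_total k n with h | h
    · exact hagree k n h n hn
    · exact (hagree n k h n (hlt n)).symm
  have htiling : ∀ k j, k ≤ j → ∃ S, IsTiling (w k) (l k) (w (j + 1)) S ∧
      ∃ t ∈ S, l (j + 1) = t + l k := by
    intro k j hkj
    induction j, hkj using Nat.le_induction with
    | base =>
      obtain ⟨t, ht, -, he⟩ := hl k
      exact ⟨_, hw k ▸ isTiling_drift _ _, t, ht, he⟩
    | succ j hj ih =>
      obtain ⟨S, hS, t, ht, he⟩ := ih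
      obtain ⟨t', ht', -, he'⟩ := hl (j + 1)
      have hS' := isTiling_drift (w (j + 1)) (l (j + 1))
      rw [← hw (j + 1), he] at hS'
      rw [he] at ht'
      exact ⟨_, hS.trans ht hS', t' + t, ⟨t', ht', t, ht, le_rfl, rfl⟩, by omega⟩
  refine ⟨positiveSupport x, positiveSupport_mem_dynamicallyCentralSyndetic (hw0 0) ?_, ?_⟩
  · intro r
    refine ⟨l r + 1, fun n => ?_⟩
    -- The stage depends on `n` so that its word agrees with `x` beyond `n + 2 * l r`; the gap bound
    -- depends on `r` alone.
    obtain ⟨S, hS, -⟩ := htiling r (n + 2 * l r) (by have := hlt r; omega)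
    obtain ⟨j, hj, hmem⟩ := hS.exists_mem_between (Nat.zero_lt_of_lt (hlt r)) n
    refine ⟨j, by omega, fun i hi => ?_⟩
    have hir : i < l r := hi.trans (hlt r)
    rw [hx (n + 2 * l r + 1) _ (by have := hlt (n + 2 * l r + 1); omega),
      hS.apply_eq _ hmem i hir, hx r i hir]
  · intro k
    exact havoid k (p k) x fun n hn => hx (k + 1) n hn

/-- The diagonal set is central syndetic while the avoided families need only be syndetic, so one
argument covers every `F` in between. -/
theorem not_isSigmaCompactFamily {F : Set (Set ℕ+)} (h₁ : dynamicallyCentralSyndetic ⊆ F)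
    (h₂ : F ⊆ dynamicallySyndetic) : ¬ IsSigmaCompactFamily F := by
  rintro ⟨K, hK, hKF⟩
  have hinj : Function.Injective (Set.boolIndicator : Set ℕ+ → ℕ+ → Bool) := by
    intro A B hAB
    ext n
    rw [Set.mem_iff_boolIndicator, hAB, ← Set.mem_iff_boolIndicator]
  obtain ⟨A, hA, hAK⟩ := exists_centralSyndetic_avoiding (fun k => (hK k).isClosed)
    fun k A hA => by
      have hmem : A.boolIndicator ∈ Set.boolIndicator '' F := hKF ▸ Set.mem_iUnion_of_mem k hA
      exact h₂ ((hinj.mem_set_image).1 hmem)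
  have hmem : A.boolIndicator ∈ ⋃ k, K k := hKF ▸ Set.mem_image_of_mem _ (h₁ hA)
  obtain ⟨k, hk⟩ := Set.mem_iUnion.1 hmem
  exact hAK k hk

theorem theoremE :
    dualFamily dynamicallyThick = dynamicallySyndetic ∧
    dualFamily pointwiseRecurrence = dynamicallyCentralSyndetic ∧
    ¬ IsSigmaCompactFamily dynamicallySyndetic ∧
    ¬ IsSigmaCompactFamily dynamicallyCentralSyndetic :=
  ⟨dualFamily_dynamicallyThick, dualFamily_pointwiseRecurrence,
    not_isSigmaCompactFamily dynamicallyCentralSyndetic_subset subset_rfl,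
    not_isSigmaCompactFamily subset_rfl dynamicallyCentralSyndetic_subset⟩
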